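/- **Theorem (Percolation result).** *Setting.* Let $s\in(0,1)$, $a>0$, $V\in(0,1)$, $0<\varepsilon_0<\min\{V,1-V\}$, and let $\varepsilon(L)>0$ $(L\in\mathbb N)$ satisfy $a/L\ll\varepsilon(L)\ll 1$, that is, $a/(L\,\varepsilon(L))\to0$ and $\varepsilon(L)\to 0$ as $L\to\infty$. For a density $\nu>0$ and $L\in\mathbb N$, let $\lfloor\nu L^2\rfloor$ points (grain centres; exactly $\nu L^2$ when this is an integer) be independent and uniformly distributed in $[0,L]^2$. Consider those $L$ for which $M:=\varepsilon(L)L$, $1/\varepsilon(L)$ and $2\varepsilon_0/\varepsilon(L)$ are integers, and divide $[0,L]\times[(V-\varepsilon_0)L,(V+\varepsilon_0)L]$ into the $\frac1{\varepsilon(L)}\cdot\frac{2\varepsilon_0}{\varepsilon(L)}$ boxes $Q$ of side $M$. Divide each $Q$ into $M^2$ closed unit squares $S_\kappa$, $\kappa=(i,j)\in\{1,\dots,M\}^2$, where $(i,j)$ is the top-right corner of $S_\kappa$ in coordinates in which $Q=[0,M]^2$; let $R_\kappa$ be the closed square of area $s$, with sides parallel to those of $S_\kappa$, centred in $S_\kappa$.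 The *site* $\kappa$ is *open* if at least one grain centre lies in $R_\kappa$. A *chain* is a finite sequence of at least two distinct open sites such that consecutive ones are at Euclidean distance $1$ in $\{1,\dots,M\}^2$. The four sides of the box are the sets of sites $\partial_1=\{j=1\}$, $\partial_2=\{i=1\}$, $\partial_3=\{j=M\}$, $\partial_4=\{i=M\}$. *Statement.* For every $s\in(0,1)$ there are $\nu_0>0$ and $K>0$, depending only on $s$, and for all $a,V,\varepsilon_0,\varepsilon(\cdot)$ as above there is $L_0>0$, such that the following holds for all $\nu\ge\nu_0$, all $L\ge L_0$ for which $M=\varepsilon(L)L$, $1/\varepsilon(L)$, $2\varepsilon_0/\varepsilon(L)$ are integers, and every box $Q$ of the partition. Let $A_1\subset\partial_k$ and $A_2\subset\partial_l$ with $k\ne l$ be disjoint sets of sites of $Q$, each topologically connected (the union of its unit squares $S_\kappa$ is connected) and with numbers of sites $N_1,N_2\in(M/4,M/2)$. Then the probability that there is a chain that meets both $A_1$ and $A_2$ is at least $$1-e^{-K\,\varepsilon(L)\,L}.$$ -/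

import Mathlib

open Filter Topology MeasureTheory ProbabilityTheory Asymptotics

noncomputable section

namespace GrainPercolation

/-- The number of grain centres in `[0, L]²` at density `ν`. -/
def numGrains (ν : ℝ) (L : ℕ) : ℕ := ⌊ν * (L : ℝ) ^ 2⌋₊

/-- The law `μ_ν` of the configuration `ω = (ξ_j)_j` of grain centres: `⌊ν L²⌋` independent points,
each uniformly distributed in the square `[0, L]²`. -/
def grainLaw (ν : ℝ) (L : ℕ) : Measure (Fin (numGrains ν L) → ℝ × ℝ) :=
  Measure.pi fun _ => ProbabilityTheory.cond volume (Set.Icc (0 : ℝ) L ×ˢ Set.Icc (0 : ℝ) L)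

/-- The site labels `{1, …, M}²` of a box of side `M`. -/
abbrev Site (M : ℕ) : Type := Set.Icc 1 M × Set.Icc 1 M

/-- The lower left corner of the box in column `p` and row `q` (counted from `0`) of the partition
of `[0, L] × [(V - ε₀) L, (V + ε₀) L]` into squares of side `ε L`. -/
def boxCorner (V ε₀ ε : ℝ) (L p q : ℕ) : ℝ × ℝ :=
  (p * (ε * L), (V - ε₀) * L + q * (ε * L))

/-- The closed unit square `S_κ` of the box with lower left corner `c`; relative to `c`, its top
right corner is `κ`. -/
def unitSquare {M : ℕ} (c : ℝ × ℝ) (κ : Site M) : Set (ℝ × ℝ) :=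
  Set.Icc (c.1 + (κ.1 : ℕ) - 1) (c.1 + (κ.1 : ℕ)) ×ˢ
    Set.Icc (c.2 + (κ.2 : ℕ) - 1) (c.2 + (κ.2 : ℕ))

/-- The closed square `R_κ` of area `s` (side `√s`) centred in `S_κ`. -/
def centralSquare {M : ℕ} (s : ℝ) (c : ℝ × ℝ) (κ : Site M) : Set (ℝ × ℝ) :=
  {x | |x.1 - (c.1 + (κ.1 : ℕ) - 1 / 2)| ≤ √s / 2 ∧ |x.2 - (c.2 + (κ.2 : ℕ) - 1 / 2)| ≤ √s / 2}

/-- Configurations of sites: `1` is open, `0` is closed. -/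
abbrev Config (M : ℕ) : Type := Site M → Fin 2

open Classical in
/-- The configuration of sites induced by the grain centres `ω`: the site `κ` is open if and only
if at least one centre falls in `R_κ`. -/
def siteConfig {N : ℕ} (M : ℕ) (s : ℝ) (c : ℝ × ℝ) (ω : Fin N → ℝ × ℝ) : Config M :=
  fun κ => if ∃ j, ω j ∈ centralSquare s c κ then 1 else 0

/-- The probability induced by `μ_ν` on the configurations of sites of the box with corner `c`. -/
def siteProb (ν s : ℝ) (L M : ℕ) (c : ℝ × ℝ) (E : Set (Config M)) : ℝ :=
  (grainLaw ν L).real {ω | siteConfig M s c ω ∈ E}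

/-- The four sides of the box (bottom, left, top, right), as sets of sites. -/
def side (M : ℕ) : Fin 4 → Set (Site M)
  | 0 => {κ | (κ.2 : ℕ) = 1}
  | 1 => {κ | (κ.1 : ℕ) = 1}
  | 2 => {κ | (κ.2 : ℕ) = M}
  | 3 => {κ | (κ.1 : ℕ) = M}

/-- A set of sites is a topologically connected region if the union of its closed unit squares is
a connected subset of the plane. -/
def IsConnectedRegion {M : ℕ} (c : ℝ × ℝ) (A : Finset (Site M)) : Prop :=
  IsConnected (⋃ κ ∈ A, unitSquare c κ)

/-- Two sites are adjacent in the configuration `η` if they are both open and their labels are at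
Euclidean distance `1`. -/
def Adjacent {M : ℕ} (η : Config M) (κ κ' : Site M) : Prop :=
  (((κ.1 : ℕ) : ℤ) - (κ'.1 : ℕ)) ^ 2 + (((κ.2 : ℕ) : ℤ) - (κ'.2 : ℕ)) ^ 2 = 1 ∧
    η κ = 1 ∧ η κ' = 1

/-- A chain: at least two distinct sites, every two consecutive ones adjacent. -/
def IsOpenChain {M : ℕ} (η : Config M) (l : List (Site M)) : Prop :=
  2 ≤ l.length ∧ l.Nodup ∧ l.IsChain (Adjacent η)

/-- `C(A₁, A₂)`: the configurations for which some chain intersects both `A₁` and `A₂`. -/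
def connectionEvent {M : ℕ} (A₁ A₂ : Finset (Site M)) : Set (Config M) :=
  {η | ∃ l : List (Site M), IsOpenChain η l ∧ (∃ κ ∈ l, κ ∈ A₁) ∧ (∃ κ ∈ l, κ ∈ A₂)}

end GrainPercolation

end

noncomputable section

namespace GrainPercolation

/-! ### Discrete potentials on a square grid -/

/-! This is a Peierls argument. If no chain joins `A₁` and `A₂`, there is a self-avoiding path of `n
= ⌈M / 4⌉` closed sites with steps of max-norm length one. There are at most `M² 9ⁿ⁻¹` such paths.
Given `n` sites, all are closed with probability at most `exp (-n s (ν - 1))`, because each of the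
independent centres has to miss a set of area `n s` (`grainLaw_closed_le`). For large `ν` the second
factor wins.

The closed path (`exists_isClosedPath`) is found by discrete potentials instead of a Jordan curve
argument. Let `g` be the indicator of the sites reachable from `A₁` through open sites. It changes
only along edges with a closed endpoint, so its gradient splits into pieces, one for each max-norm
component `W t` of closed sites. A plaquette touches at most one component, so each piece is
curl-free (`localDiff_plaquette`) and has a potential; the potentials add up to `g - g (1, 1)`
(`sum_potential`).

Without a closed path of `n` sites, every `W t` has extension less than `n - 1` in both directions.
It therefore misses a row, a column, and a line crossing any given segment of `n` sites. Its
potential is constant on the connected grid of all missed lines, hence equal on `A₁` and `A₂`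
(`potential_eq_of_segment`). Summation over `t` makes `g` equal on `A₁` and `A₂`, where it is `1`
and `0`. -/

open Classical in
/-- The increment of `g` from `u` to `v`, kept only if one of the two points is in `S`. -/
def localDiff (S : Set (ℕ × ℕ)) (g : ℕ × ℕ → ℤ) (u v : ℕ × ℕ) : ℤ :=
  if u ∈ S ∨ v ∈ S then g v - g u else 0

/-- The sum of the increments `localDiff S g` along the path from `(1, 1)` to `(i, j)` that first
follows the bottom row and then a column. -/
def potential (S : Set (ℕ × ℕ)) (g : ℕ × ℕ → ℤ) (i j : ℕ) : ℤ :=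
  ∑ k ∈ Finset.Ico 1 i, localDiff S g (k, 1) (k + 1, 1) +
    ∑ k ∈ Finset.Ico 1 j, localDiff S g (i, k) (i, k + 1)

/-- The sets `W t` are at mutual distance at least two in the maximum norm, and every edge of the
grid `{1, …, M}²` along which `g` varies meets one of them. -/
structure IsSeparatedCover {ι : Type*} (M : ℕ) (g : ℕ × ℕ → ℤ) (W : ι → Set (ℕ × ℕ)) :
    Prop where
  eq_of_near : ∀ t t' u v, u ∈ W t → v ∈ W t' → u.1 ≤ v.1 + 1 → v.1 ≤ u.1 + 1 →
    u.2 ≤ v.2 + 1 → v.2 ≤ u.2 + 1 → t = t'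
  cover_row : ∀ i j, 1 ≤ i → i < M → 1 ≤ j → j ≤ M → g (i, j) ≠ g (i + 1, j) →
    ∃ t, (i, j) ∈ W t ∨ (i + 1, j) ∈ W t
  cover_col : ∀ i j, 1 ≤ i → i ≤ M → 1 ≤ j → j < M → g (i, j) ≠ g (i, j + 1) →
    ∃ t, (i, j) ∈ W t ∨ (i, j + 1) ∈ W t

lemma localDiff_eq_zero {S : Set (ℕ × ℕ)} {g : ℕ × ℕ → ℤ} {u v : ℕ × ℕ}
    (h : g u = g v ∨ (u ∉ S ∧ v ∉ S)) : localDiff S g u v = 0 := by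
  unfold localDiff
  split_ifs with h' <;> grind

lemma potential_succ_right (S : Set (ℕ × ℕ)) (g : ℕ × ℕ → ℤ) (i : ℕ) {j : ℕ} (hj : 1 ≤ j) :
    potential S g i (j + 1) = potential S g i j + localDiff S g (i, j) (i, j + 1) := by
  simp only [potential, Finset.sum_Ico_succ_top hj]
  ring

namespace IsSeparatedCover

variable {ι : Type*} {M : ℕ} {g : ℕ × ℕ → ℤ} {W : ι → Set (ℕ × ℕ)}

/-- Near a point of `W t`, all the variation of `g` is attributed to `W t`. -/
lemma localDiff_eq_sub (h : IsSeparatedCover M g W) {t : ι} {u v w : ℕ × ℕ} (hw : w ∈ W t)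
    (huv : g u ≠ g v → ∃ t, u ∈ W t ∨ v ∈ W t)
    (hu : u.1 ≤ w.1 + 1 ∧ w.1 ≤ u.1 + 1 ∧ u.2 ≤ w.2 + 1 ∧ w.2 ≤ u.2 + 1)
    (hv : v.1 ≤ w.1 + 1 ∧ w.1 ≤ v.1 + 1 ∧ v.2 ≤ w.2 + 1 ∧ w.2 ≤ v.2 + 1) :
    localDiff (W t) g u v = g v - g u := by
  by_cases hg : g u = g v
  · rw [localDiff_eq_zero (Or.inl hg), hg, sub_self]
  · obtain ⟨t', ht'⟩ := huv hg
    have : t' = t := by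
      rcases ht' with h' | h'
      · exact h.eq_of_near _ _ _ _ h' hw hu.1 hu.2.1 hu.2.2.1 hu.2.2.2
      · exact h.eq_of_near _ _ _ _ h' hw hv.1 hv.2.1 hv.2.2.1 hv.2.2.2
    subst this
    simp [localDiff, ht']

/-- The increments attributed to one of the sets have no circulation around a plaquette. -/
lemma localDiff_plaquette (h : IsSeparatedCover M g W) (t : ι) {i j : ℕ} (hi : 1 ≤ i) (hiM : i < M)
    (hj : 1 ≤ j) (hjM : j < M) :
    localDiff (W t) g (i, j) (i + 1, j) + localDiff (W t) g (i + 1, j) (i + 1, j + 1) =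
      localDiff (W t) g (i, j) (i, j + 1) + localDiff (W t) g (i, j + 1) (i + 1, j + 1) := by
  have h1 := h.cover_row i j hi hiM hj hjM.le
  have h2 := h.cover_row i (j + 1) hi hiM (by omega) hjM
  have h3 := h.cover_col i j hi hiM.le hj hjM
  have h4 := h.cover_col (i + 1) j (by omega) hiM hj hjM
  -- If a corner lies in `W t`, all four increments are true increments of `g` and telescope;
  -- otherwise all four vanish.
  by_cases hw : ∃ w ∈ W t, i ≤ w.1 ∧ w.1 ≤ i + 1 ∧ j ≤ w.2 ∧ w.2 ≤ j + 1
  · obtain ⟨w, hw, hb⟩ := hw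
    rw [h.localDiff_eq_sub hw h1 (by simp; omega) (by simp; omega),
      h.localDiff_eq_sub hw h2 (by simp; omega) (by simp; omega),
      h.localDiff_eq_sub hw h3 (by simp; omega) (by simp; omega),
      h.localDiff_eq_sub hw h4 (by simp; omega) (by simp; omega)]
    ring
  · push Not at hw
    have e : ∀ a b, i ≤ a → a ≤ i + 1 → j ≤ b → b ≤ j + 1 → (a, b) ∉ W t := by
      intro a b h1 h2 h3 h4 h5
      have := hw _ h5 h1 h2 h3
      simp at this
      omega
    have e1 := e i j (by omega) (by omega) (by omega) (by omega)
    have e2 := e (i + 1) j (by omega) (by omega) (by omega) (by omega)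
    have e3 := e i (j + 1) (by omega) (by omega) (by omega) (by omega)
    have e4 := e (i + 1) (j + 1) (by omega) (by omega) (by omega) (by omega)
    rw [localDiff_eq_zero (Or.inr ⟨e1, e2⟩), localDiff_eq_zero (Or.inr ⟨e2, e4⟩),
      localDiff_eq_zero (Or.inr ⟨e1, e3⟩), localDiff_eq_zero (Or.inr ⟨e3, e4⟩)]

/-- Path independence: the horizontal step is moved up from the bottom row one plaquette at a time.
-/
lemma potential_succ_left (h : IsSeparatedCover M g W) (t : ι) {i j : ℕ} (hi : 1 ≤ i)
    (hiM : i < M) (hj : 1 ≤ j) (hjM : j ≤ M) :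
    potential (W t) g (i + 1) j =
      potential (W t) g i j + localDiff (W t) g (i, j) (i + 1, j) := by
  induction j, hj using Nat.le_induction with
  | base => simp [potential, Finset.sum_Ico_succ_top hi]
  | succ j hj ih =>
    have := h.localDiff_plaquette t hi hiM hj hjM
    rw [potential_succ_right _ _ _ hj, potential_succ_right _ _ _ hj, ih (by omega)]
    linarith

/-- By separation, the two ends of an edge cannot meet two different sets, so exactly one summand
carries a nonzero increment. -/
lemma sum_localDiff [Fintype ι] (h : IsSeparatedCover M g W) {u v : ℕ × ℕ}
    (huv : g u ≠ g v → ∃ t, u ∈ W t ∨ v ∈ W t)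
    (hd : u.1 ≤ v.1 + 1 ∧ v.1 ≤ u.1 + 1 ∧ u.2 ≤ v.2 + 1 ∧ v.2 ≤ u.2 + 1) :
    ∑ t, localDiff (W t) g u v = g v - g u := by
  by_cases hg : g u = g v
  · rw [Finset.sum_eq_zero fun t _ => localDiff_eq_zero (Or.inl hg), hg, sub_self]
  · obtain ⟨t, ht⟩ := huv hg
    have key : ∀ t', u ∈ W t' ∨ v ∈ W t' → t' = t := by
      intro t' ht'
      rcases ht with ht | ht <;> rcases ht' with ht' | ht' <;>
        exact h.eq_of_near _ _ _ _ ht' ht (by omega) (by omega) (by omega) (by omega)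
    rw [Finset.sum_eq_single t]
    · simp [localDiff, ht]
    · intro t' _ hne
      have : ¬ (u ∈ W t' ∨ v ∈ W t') := fun h' => hne (key t' h')
      simp [localDiff, this]
    · simp

lemma sum_potential [Fintype ι] (h : IsSeparatedCover M g W) {i j : ℕ} (hi : 1 ≤ i)
    (hiM : i ≤ M) (hj : 1 ≤ j) (hjM : j ≤ M) :
    ∑ t, potential (W t) g i j = g (i, j) - g (1, 1) := by
  induction j, hj using Nat.le_induction with
  | base =>
    induction i, hi using Nat.le_induction with
    | base => simp [potential]
    | succ i hi ih =>
      simp_rw [fun t => h.potential_succ_left t hi hiM le_rfl hjM]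
      rw [Finset.sum_add_distrib, ih (by omega),
        h.sum_localDiff (h.cover_row i 1 hi hiM le_rfl hjM) (by simp; omega)]
      ring
  | succ j hj ih =>
    simp_rw [fun t => potential_succ_right (W t) g i hj]
    rw [Finset.sum_add_distrib, ih (by omega),
      h.sum_localDiff (h.cover_col i j hi hiM hj hjM) (by simp; omega)]
    ring

end IsSeparatedCover

/-! ### Grids of rows and columns that avoid a small set -/

/-- A function on an interval of integers with vanishing increments is constant. -/
lemma eq_of_succ_eq {f : ℕ → ℤ} {a b : ℕ} (h : ∀ k, a ≤ k → k < b → f (k + 1) = f k) {x y : ℕ}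
    (hx : a ≤ x) (hxb : x ≤ b) (hy : a ≤ y) (hyb : y ≤ b) : f x = f y := by
  have key : ∀ z, a ≤ z → z ≤ b → f z = f a := by
    intro z hz
    induction z, hz using Nat.le_induction with
    | base => simp
    | succ z hz ih => intro hb; rw [h z hz (by omega), ih (by omega)]
  rw [key x hx hxb, key y hy hyb]

/-- If `f` is constant along the lines of a grid in `C` (columns) and `R` (rows) and along a
horizontal segment that meets a column in `C`, then its value on the segment is the one at the
intersection of any column in `C` and any row in `R`. -/
lemma eq_of_segment_meets_column {M : ℕ} {f : ℕ → ℕ → ℤ} {C R : ℕ → Prop}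
    (hC : ∀ i j, 1 ≤ i → i ≤ M → C i → 1 ≤ j → j < M → f i (j + 1) = f i j)
    (hR : ∀ i j, 1 ≤ j → j ≤ M → R j → 1 ≤ i → i < M → f (i + 1) j = f i j)
    {i₀ j₀ : ℕ} (hi₀ : 1 ≤ i₀ ∧ i₀ ≤ M) (hj₀ : 1 ≤ j₀ ∧ j₀ ≤ M) (hRj : R j₀)
    {p q y x a : ℕ} (hp : 1 ≤ p) (hq : q ≤ M) (hy : 1 ≤ y ∧ y ≤ M)
    (hseg : ∀ i, p ≤ i → i < q → f (i + 1) y = f i y)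
    (hx : p ≤ x ∧ x ≤ q) (hCx : C x) (ha : p ≤ a ∧ a ≤ q) : f a y = f i₀ j₀ := by
  calc f a y = f x y := eq_of_succ_eq (f := fun i => f i y) hseg ha.1 ha.2 hx.1 hx.2
    _ = f x j₀ := eq_of_succ_eq (f := fun j => f x j) (a := 1) (b := M)
        (fun k h1 h2 => hC x k (by omega) (by omega) hCx h1 h2) hy.1 hy.2 hj₀.1 hj₀.2
    _ = f i₀ j₀ := eq_of_succ_eq (f := fun i => f i j₀) (a := 1) (b := M)
        (fun k h1 h2 => hR k j₀ hj₀.1 hj₀.2 hRj h1 h2) (by omega) (by omega) hi₀.1 hi₀.2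

/-- A set of naturals whose elements differ by less than `n - 1` misses a point of every finite
set with `n` elements. -/
lemma exists_notMem_of_diff_lt {n : ℕ} {X : Set ℕ} (hn : 1 ≤ n)
    (hX : ∀ x ∈ X, ∀ y ∈ X, y + 1 < x + n) {Y : Finset ℕ} (hY : n ≤ Y.card) :
    ∃ y ∈ Y, y ∉ X := by
  by_contra! hcon
  have hne : Y.Nonempty := Finset.card_pos.mp (by omega)
  have hsub : Y ⊆ Finset.Ico (Y.min' hne) (Y.min' hne + (n - 1)) := by
    intro y hy
    have := hX _ (hcon _ (Y.min'_mem hne)) _ (hcon _ hy)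
    rw [Finset.mem_Ico]
    exact ⟨Y.min'_le _ hy, by omega⟩
  have := Finset.card_le_card hsub
  simp at this
  omega

/-! ### Sites, segments and closed paths -/

/-- The coordinates of a site. -/
def pos {M : ℕ} (κ : Site M) : ℕ × ℕ := (κ.1, κ.2)

lemma pos_injective {M : ℕ} : Function.Injective (pos (M := M)) := by
  rintro ⟨a, b⟩ ⟨c, d⟩ h
  simp only [pos, Prod.mk.injEq] at h
  exact Prod.ext (Subtype.ext h.1) (Subtype.ext h.2)

lemma exists_pos_eq {M i j : ℕ} (hi : 1 ≤ i) (hiM : i ≤ M) (hj : 1 ≤ j) (hjM : j ≤ M) :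
    ∃ κ : Site M, pos κ = (i, j) := ⟨(⟨i, hi, hiM⟩, ⟨j, hj, hjM⟩), rfl⟩

/-- A horizontal segment of sites. -/
def IsRowSegment {M : ℕ} (A : Finset (Site M)) : Prop :=
  ∃ c, (∀ κ ∈ A, (κ.2 : ℕ) = c) ∧ ∀ κ ∈ A, ∀ κ' ∈ A, ∀ κ'' : Site M,
    (κ''.2 : ℕ) = c → (κ.1 : ℕ) ≤ κ''.1 → (κ''.1 : ℕ) ≤ κ'.1 → κ'' ∈ A

/-- A vertical segment of sites. -/
def IsColSegment {M : ℕ} (A : Finset (Site M)) : Prop :=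
  ∃ c, (∀ κ ∈ A, (κ.1 : ℕ) = c) ∧ ∀ κ ∈ A, ∀ κ' ∈ A, ∀ κ'' : Site M,
    (κ''.1 : ℕ) = c → (κ.2 : ℕ) ≤ κ''.2 → (κ''.2 : ℕ) ≤ κ'.2 → κ'' ∈ A

/-- Two sites are near if their distance in the maximum norm is at most one. -/
def Near {M : ℕ} (κ κ' : Site M) : Prop :=
  (κ.1 : ℕ) ≤ κ'.1 + 1 ∧ (κ'.1 : ℕ) ≤ κ.1 + 1 ∧ (κ.2 : ℕ) ≤ κ'.2 + 1 ∧ (κ'.2 : ℕ) ≤ κ.2 + 1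

/-- The graph of open sites, with the adjacency of chains. -/
def openGraph {M : ℕ} (η : Config M) : SimpleGraph (Site M) where
  Adj := Adjacent η
  symm := ⟨by
    intro κ κ' h
    refine ⟨?_, h.2.2, h.2.1⟩
    rw [← h.1]; ring⟩
  loopless := ⟨fun κ h => by simpa using h.1⟩

/-- The graph of closed sites, two of which are adjacent if they are near. -/
def closedGraph {M : ℕ} (η : Config M) : SimpleGraph (Site M) where
  Adj κ κ' := κ ≠ κ' ∧ Near κ κ' ∧ η κ ≠ 1 ∧ η κ' ≠ 1
  symm := ⟨fun _ _ h => ⟨h.1.symm, ⟨h.2.1.2.1, h.2.1.1, h.2.1.2.2.2, h.2.1.2.2.1⟩,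
    h.2.2.2, h.2.2.1⟩⟩
  loopless := ⟨fun _ h => h.1 rfl⟩

/-- A self-avoiding path of closed sites, with steps of length at most one in the maximum norm. -/
def IsClosedPath {M : ℕ} (η : Config M) (l : List (Site M)) : Prop :=
  l.Nodup ∧ l.IsChain Near ∧ ∀ κ ∈ l, η κ ≠ 1

/-- A simple path in the open graph is a chain; disjointness of the two sets excludes the path with
a single site. -/
lemma mem_connectionEvent_of_reachable {M : ℕ} {η : Config M} {A₁ A₂ : Finset (Site M)}
    (hd : Disjoint A₁ A₂) {a b : Site M} (ha : a ∈ A₁) (hb : b ∈ A₂)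
    (h : (openGraph η).Reachable a b) : η ∈ connectionEvent A₁ A₂ := by
  obtain ⟨p, hp⟩ := h.exists_isPath
  refine ⟨p.support, ⟨?_, hp.support_nodup, p.isChain_adj_support⟩,
    ⟨a, p.start_mem_support, ha⟩, ⟨b, p.end_mem_support, hb⟩⟩
  rw [SimpleGraph.Walk.length_support]
  have : p.length ≠ 0 := fun h0 =>
    Finset.disjoint_left.mp hd ha (SimpleGraph.Walk.eq_of_length_eq_zero h0 ▸ hb)
  omega

lemma closed_of_walk {M : ℕ} {η : Config M} {u v : Site M} (p : (closedGraph η).Walk u v)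
    (hu : η u ≠ 1) : ∀ κ ∈ p.support, η κ ≠ 1 := by
  induction p with
  | nil => simpa using hu
  | cons h p ih =>
    intro κ hκ
    rw [SimpleGraph.Walk.support_cons, List.mem_cons] at hκ
    rcases hκ with rfl | hκ
    · exact hu
    · exact ih h.2.2.2 κ hκ

lemma coord_le_of_walk {M : ℕ} {η : Config M} {u v : Site M} (p : (closedGraph η).Walk u v) :
    (v.1 : ℕ) ≤ u.1 + p.length ∧ (v.2 : ℕ) ≤ u.2 + p.length := by
  induction p with
  | nil => simp
  | cons h p ih =>
    rw [SimpleGraph.Walk.length_cons]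
    have hN := h.2.1
    unfold Near at hN
    omega

/-- A component of closed sites with large extension contains a long closed path. -/
lemma exists_isClosedPath_of_reachable {M n : ℕ} {η : Config M} (hn : 1 ≤ n) {u v : Site M}
    (hu : η u ≠ 1) (h : (closedGraph η).Reachable u v)
    (huv : (u.1 : ℕ) + n ≤ v.1 + 1 ∨ (u.2 : ℕ) + n ≤ v.2 + 1) :
    ∃ l, IsClosedPath η l ∧ l.length = n := by
  obtain ⟨p, hp⟩ := h.exists_isPath
  have hlen := coord_le_of_walk p
  -- The extension forces at least `n - 1` steps, and `n - 1` steps visit `n` sites.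
  have hq : (p.take (n - 1)).length = n - 1 := by
    rw [SimpleGraph.Walk.take_length]; omega
  refine ⟨(p.take (n - 1)).support, ⟨(hp.take _).support_nodup, ?_, closed_of_walk _ hu⟩, ?_⟩
  · exact (SimpleGraph.Walk.isChain_adj_support _).imp fun a b h => h.2.1
  · rw [SimpleGraph.Walk.length_support, hq]; omega

/-! ### The dichotomy: a chain or a long closed path -/

/-- On a segment of at least `n` sites along which `g` is constant, the potential of a set with
small extension is the one at the intersection of a column and a row that avoid the set. -/
lemma potential_eq_of_segment {ι : Type*} {M n : ℕ} {g : ℕ × ℕ → ℤ} {W : ι → Set (ℕ × ℕ)}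
    (h : IsSeparatedCover M g W) (t : ι) (hn : 1 ≤ n)
    (hW : ∀ u ∈ W t, ∀ v ∈ W t, v.1 + 1 < u.1 + n ∧ v.2 + 1 < u.2 + n)
    {A : Finset (Site M)} (hA : IsRowSegment A ∨ IsColSegment A) (hcard : n ≤ A.card)
    (hg : ∀ κ ∈ A, ∀ κ' ∈ A, g (pos κ) = g (pos κ'))
    {i₀ j₀ : ℕ} (hi₀ : 1 ≤ i₀ ∧ i₀ ≤ M) (hj₀ : 1 ≤ j₀ ∧ j₀ ≤ M)
    (hC₀ : ∀ u ∈ W t, u.1 ≠ i₀) (hR₀ : ∀ u ∈ W t, u.2 ≠ j₀) {κ : Site M} (hκ : κ ∈ A) :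
    potential (W t) g κ.1 κ.2 = potential (W t) g i₀ j₀ := by
  have hC : ∀ i j, 1 ≤ i → i ≤ M → (∀ u ∈ W t, u.1 ≠ i) → 1 ≤ j → j < M →
      potential (W t) g i (j + 1) = potential (W t) g i j := by
    intro i j _ _ hi hj _
    rw [potential_succ_right _ _ _ hj, localDiff_eq_zero, add_zero]
    exact Or.inr ⟨fun hm => hi _ hm rfl, fun hm => hi _ hm rfl⟩
  have hR : ∀ i j, 1 ≤ j → j ≤ M → (∀ u ∈ W t, u.2 ≠ j) → 1 ≤ i → i < M →
      potential (W t) g (i + 1) j = potential (W t) g i j := by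
    intro i j hj hjM hf hi hiM
    rw [h.potential_succ_left t hi hiM hj hjM, localDiff_eq_zero, add_zero]
    exact Or.inr ⟨fun hm => hf _ hm rfl, fun hm => hf _ hm rfl⟩
  have hκ1 := κ.1.2
  have hκ2 := κ.2.2
  rw [Set.mem_Icc] at hκ1 hκ2
  rcases hA with ⟨c, hc, hseg⟩ | ⟨c, hc, hseg⟩
  · have hinj : (A.image fun κ => (κ.1 : ℕ)).card = A.card := by
      refine Finset.card_image_of_injOn fun a ha b hb hab => pos_injective ?_
      exact Prod.ext hab ((hc a ha).trans (hc b hb).symm)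
    -- The sites of a row segment occupy at least `n` columns, too many for all of them to meet `W
    -- t`.
    obtain ⟨x, hx, hxW⟩ := exists_notMem_of_diff_lt (X := {x | ∃ u ∈ W t, u.1 = x}) hn
      (by rintro _ ⟨u, hu, rfl⟩ _ ⟨v, hv, rfl⟩; exact (hW u hu v hv).1) (hcard.trans hinj.ge)
    obtain ⟨κ', hκ', rfl⟩ := Finset.mem_image.mp hx
    have hκ'1 := κ'.1.2
    rw [Set.mem_Icc] at hκ'1
    have hmem : ∀ i, min (κ.1 : ℕ) κ'.1 ≤ i → i ≤ max (κ.1 : ℕ) κ'.1 →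
        ∃ κ'' ∈ A, pos κ'' = (i, (κ.2 : ℕ)) := by
      intro i h1 h2
      obtain ⟨κ'', h''⟩ := exists_pos_eq (M := M) (i := i) (by omega) (by omega) hκ2.1 hκ2.2
      refine ⟨κ'', ?_, h''⟩
      simp only [pos, Prod.mk.injEq] at h''
      rcases le_total (κ.1 : ℕ) κ'.1 with hle | hle
      · exact hseg κ hκ κ' hκ' κ'' (h''.2.trans (hc κ hκ)) (by omega) (by omega)
      · exact hseg κ' hκ' κ hκ κ'' (h''.2.trans (hc κ hκ)) (by omega) (by omega)
    refine eq_of_segment_meets_column (p := min (κ.1 : ℕ) κ'.1) (q := max (κ.1 : ℕ) κ'.1)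
      (x := (κ'.1 : ℕ)) hC hR hi₀ hj₀ hR₀ (by omega) (by omega) hκ2 ?_ (by omega) ?_ (by omega)
    · intro i h1 h2
      obtain ⟨a, ha, hai⟩ := hmem i h1 h2.le
      obtain ⟨b, hb, hbi⟩ := hmem (i + 1) (by omega) h2
      rw [h.potential_succ_left t (by omega) (by omega) hκ2.1 hκ2.2, localDiff_eq_zero, add_zero]
      exact Or.inl (hai ▸ hbi ▸ hg a ha b hb)
    · exact fun u hu hue => hxW ⟨u, hu, hue⟩
  · have hinj : (A.image fun κ => (κ.2 : ℕ)).card = A.card := by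
      refine Finset.card_image_of_injOn fun a ha b hb hab => pos_injective ?_
      exact Prod.ext ((hc a ha).trans (hc b hb).symm) hab
    obtain ⟨x, hx, hxW⟩ := exists_notMem_of_diff_lt (X := {x | ∃ u ∈ W t, u.2 = x}) hn
      (by rintro _ ⟨u, hu, rfl⟩ _ ⟨v, hv, rfl⟩; exact (hW u hu v hv).2) (hcard.trans hinj.ge)
    obtain ⟨κ', hκ', rfl⟩ := Finset.mem_image.mp hx
    have hκ'2 := κ'.2.2
    rw [Set.mem_Icc] at hκ'2
    have hmem : ∀ i, min (κ.2 : ℕ) κ'.2 ≤ i → i ≤ max (κ.2 : ℕ) κ'.2 →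
        ∃ κ'' ∈ A, pos κ'' = ((κ.1 : ℕ), i) := by
      intro i h1 h2
      obtain ⟨κ'', h''⟩ := exists_pos_eq (M := M) (j := i) hκ1.1 hκ1.2 (by omega) (by omega)
      refine ⟨κ'', ?_, h''⟩
      simp only [pos, Prod.mk.injEq] at h''
      rcases le_total (κ.2 : ℕ) κ'.2 with hle | hle
      · exact hseg κ hκ κ' hκ' κ'' (h''.1.trans (hc κ hκ)) (by omega) (by omega)
      · exact hseg κ' hκ' κ hκ κ'' (h''.1.trans (hc κ hκ)) (by omega) (by omega)
    -- The same lemma on the transposed grid, with rows and columns exchanged.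
    refine eq_of_segment_meets_column (f := fun j i => potential (W t) g i j)
      (p := min (κ.2 : ℕ) κ'.2) (q := max (κ.2 : ℕ) κ'.2) (x := (κ'.2 : ℕ))
      (fun i j => hR j i) (fun i j => hC j i) hj₀ hi₀ hC₀ (by omega) (by omega) hκ1 ?_
      (by omega) ?_ (by omega)
    · intro i h1 h2
      obtain ⟨a, ha, hai⟩ := hmem i h1 h2.le
      obtain ⟨b, hb, hbi⟩ := hmem (i + 1) (by omega) h2
      rw [potential_succ_right _ _ _ (by omega), localDiff_eq_zero, add_zero]
      exact Or.inl (hai ▸ hbi ▸ hg a ha b hb)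
    · exact fun u hu hue => hxW ⟨u, hu, hue⟩

open Classical in
/-- If two disjoint segments of at least `n` sites are not joined by a chain, then there is a
closed path of `n` sites. -/
theorem exists_isClosedPath {M n : ℕ} {η : Config M} (hn : 1 ≤ n) {A₁ A₂ : Finset (Site M)}
    (hA₁ : IsRowSegment A₁ ∨ IsColSegment A₁) (hA₂ : IsRowSegment A₂ ∨ IsColSegment A₂)
    (hd : Disjoint A₁ A₂) (hc₁ : n ≤ A₁.card) (hc₂ : n ≤ A₂.card) (hnM : n ≤ M)
    (hη : η ∉ connectionEvent A₁ A₂) : ∃ l, IsClosedPath η l ∧ l.length = n := by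
  by_contra hcon
  have hcon' := fun (u v : Site M) hu hr huv =>
    hcon (exists_isClosedPath_of_reachable (η := η) (u := u) (v := v) hn hu hr huv)
  let U : Set (Site M) := {κ | ∃ a ∈ A₁, (openGraph η).Reachable a κ}
  let g : ℕ × ℕ → ℤ := fun x => if ∃ κ ∈ U, pos κ = x then 1 else 0
  have hgU : ∀ κ, g (pos κ) = if κ ∈ U then 1 else 0 := by
    intro κ
    have : (∃ κ' ∈ U, pos κ' = pos κ) ↔ κ ∈ U :=
      ⟨fun ⟨κ', h, e⟩ => pos_injective e ▸ h, fun h => ⟨κ, h, rfl⟩⟩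
    simp only [g, this]
  -- An open site is isolated in `closedGraph η`, so its component gives an empty `W t`.
  let W : (closedGraph η).ConnectedComponent → Set (ℕ × ℕ) := fun t =>
    {x | ∃ κ, η κ ≠ 1 ∧ (closedGraph η).connectedComponentMk κ = t ∧ pos κ = x}
  have hclosed : ∀ κ κ' : Site M,
      (((κ.1 : ℕ) : ℤ) - (κ'.1 : ℕ)) ^ 2 + (((κ.2 : ℕ) : ℤ) - (κ'.2 : ℕ)) ^ 2 = 1 →
      g (pos κ) ≠ g (pos κ') → ∃ t, pos κ ∈ W t ∨ pos κ' ∈ W t := by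
    intro κ κ' hdist hne
    by_cases h1 : η κ = 1
    · by_cases h2 : η κ' = 1
      · exfalso
        have hadj : (openGraph η).Adj κ κ' := ⟨hdist, h1, h2⟩
        have : κ ∈ U ↔ κ' ∈ U :=
          ⟨fun ⟨a, ha, hr⟩ => ⟨a, ha, hr.trans hadj.reachable⟩,
            fun ⟨a, ha, hr⟩ => ⟨a, ha, hr.trans hadj.symm.reachable⟩⟩
        rw [hgU, hgU] at hne
        simp [this] at hne
      · exact ⟨_, Or.inr ⟨κ', h2, rfl, rfl⟩⟩
    · exact ⟨_, Or.inl ⟨κ, h1, rfl, rfl⟩⟩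
  have hcover : IsSeparatedCover M g W := by
    refine ⟨?_, ?_, ?_⟩
    · rintro t t' _ _ ⟨κ, h1, rfl, rfl⟩ ⟨κ', h2, rfl, rfl⟩ ha hb hc hd
      by_cases he : κ = κ'
      · rw [he]
      · refine SimpleGraph.ConnectedComponent.eq.mpr (SimpleGraph.Adj.reachable ?_)
        exact ⟨he, ⟨ha, hb, hc, hd⟩, h1, h2⟩
    · intro i j hi hiM hj hjM
      obtain ⟨κ, hκ⟩ := exists_pos_eq hi hiM.le hj hjM
      obtain ⟨κ', hκ'⟩ := exists_pos_eq (M := M) (i := i + 1) (by omega) hiM hj hjM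
      rw [← hκ, ← hκ']
      simp only [pos, Prod.mk.injEq] at hκ hκ'
      refine hclosed κ κ' ?_
      rw [hκ.1, hκ.2, hκ'.1, hκ'.2]
      push_cast; ring
    · intro i j hi hiM hj hjM
      obtain ⟨κ, hκ⟩ := exists_pos_eq hi hiM hj hjM.le
      obtain ⟨κ', hκ'⟩ := exists_pos_eq (M := M) (j := j + 1) hi hiM (by omega) hjM
      rw [← hκ, ← hκ']
      simp only [pos, Prod.mk.injEq] at hκ hκ'
      refine hclosed κ κ' ?_
      rw [hκ.1, hκ.2, hκ'.1, hκ'.2]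
      push_cast; ring
  have hW : ∀ t, ∀ u ∈ W t, ∀ v ∈ W t, v.1 + 1 < u.1 + n ∧ v.2 + 1 < u.2 + n := by
    rintro t _ ⟨κ, h1, h2, rfl⟩ _ ⟨κ', h3, h4, rfl⟩
    have hr := SimpleGraph.ConnectedComponent.eq.mp (h2.trans h4.symm)
    -- The pair is arbitrary and ordered, so these one-sided bounds control the full extension.
    have : ¬ (_ ∨ _) := hcon' κ κ' h1 hr
    simp only [pos]
    omega
  have hg₁ : ∀ κ ∈ A₁, g (pos κ) = 1 := by
    intro κ hκ
    rw [hgU, if_pos ⟨κ, hκ, SimpleGraph.Reachable.refl κ⟩]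
  have hg₂ : ∀ κ ∈ A₂, g (pos κ) = 0 := by
    intro κ hκ
    rw [hgU, if_neg]
    rintro ⟨a, ha, hr⟩
    exact hη (mem_connectionEvent_of_reachable hd ha hκ hr)
  obtain ⟨a, ha⟩ : A₁.Nonempty := Finset.card_pos.mp (by omega)
  obtain ⟨b, hb⟩ : A₂.Nonempty := Finset.card_pos.mp (by omega)
  have hab : ∀ t, potential (W t) g a.1 a.2 = potential (W t) g b.1 b.2 := by
    intro t
    -- The missed column `i₀` and row `j₀` depend on `t` alone, so their crossing is a common
    -- reference point for both segments.
    have hY : n ≤ (Finset.Icc 1 M).card := by simpa using hnM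
    obtain ⟨i₀, hi₀, hi₀W⟩ := exists_notMem_of_diff_lt (X := {x | ∃ u ∈ W t, u.1 = x}) hn
      (by rintro _ ⟨u, hu, rfl⟩ _ ⟨v, hv, rfl⟩; exact (hW t u hu v hv).1) hY
    obtain ⟨j₀, hj₀, hj₀W⟩ := exists_notMem_of_diff_lt (X := {x | ∃ u ∈ W t, u.2 = x}) hn
      (by rintro _ ⟨u, hu, rfl⟩ _ ⟨v, hv, rfl⟩; exact (hW t u hu v hv).2) hY
    rw [Finset.mem_Icc] at hi₀ hj₀
    rw [potential_eq_of_segment hcover t hn (hW t) hA₁ hc₁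
        (fun κ h κ' h' => by rw [hg₁ κ h, hg₁ κ' h']) hi₀ hj₀
        (fun u hu hue => hi₀W ⟨u, hu, hue⟩) (fun u hu hue => hj₀W ⟨u, hu, hue⟩) ha,
      potential_eq_of_segment hcover t hn (hW t) hA₂ hc₂
        (fun κ h κ' h' => by rw [hg₂ κ h, hg₂ κ' h']) hi₀ hj₀
        (fun u hu hue => hi₀W ⟨u, hu, hue⟩) (fun u hu hue => hj₀W ⟨u, hu, hue⟩) hb]
  have hsa := hcover.sum_potential a.1.2.1 a.1.2.2 a.2.2.1 a.2.2.2
  have hsb := hcover.sum_potential b.1.2.1 b.1.2.2 b.2.2.1 b.2.2.2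
  rw [Finset.sum_congr rfl fun t _ => hab t, hsb] at hsa
  have h1 := hg₁ a ha
  have h2 := hg₂ b hb
  simp only [pos] at h1 h2
  rw [h1, h2] at hsa
  omega

/-! ### Counting paths -/

lemma card_near_le {M : ℕ} (κ : Site M) [DecidablePred (Near κ)] :
    (Finset.univ.filter (Near κ)).card ≤ 9 := by
  have : (Finset.univ.filter (Near κ)).card ≤
      (Finset.Icc ((κ.1 : ℕ) - 1) (κ.1 + 1) ×ˢ Finset.Icc ((κ.2 : ℕ) - 1) (κ.2 + 1)).card := by
    refine Finset.card_le_card_of_injOn pos ?_ pos_injective.injOn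
    intro κ' hκ'
    simp only [Finset.coe_filter, Finset.mem_univ, true_and, Set.mem_ofPred_eq, Near] at hκ'
    simp [pos]
    omega
  refine this.trans ?_
  rw [Finset.card_product, Nat.card_Icc, Nat.card_Icc]
  calc _ ≤ 3 * 3 := Nat.mul_le_mul (by omega) (by omega)
    _ = 9 := rfl

open Classical in
/-- There are at most `M² 9ⁿ` sequences of `n + 1` successively near sites. -/
lemma exists_finset_chains (M n : ℕ) : ∃ F : Finset (List (Site M)), F.card ≤ M ^ 2 * 9 ^ n ∧
    ∀ l : List (Site M), l.length = n + 1 → l.IsChain Near → l ∈ F := by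
  induction n with
  | zero =>
    refine ⟨Finset.univ.image fun κ => [κ], Finset.card_image_le.trans ?_, ?_⟩
    · simp [sq]
    · intro l hl _
      obtain ⟨κ, rfl⟩ := List.length_eq_one_iff.mp hl
      simp
  | succ n ih =>
    obtain ⟨F, hF, hmem⟩ := ih
    refine ⟨F.biUnion fun l => (Finset.univ.filter fun κ => ∃ b ∈ l.head?, Near b κ).image
      fun κ => κ :: l, ?_, ?_⟩
    -- A chain is extended at its head; a site has at most 3 · 3 near sites, itself included.
    · rw [pow_succ 9, ← mul_assoc]
      refine (Finset.card_biUnion_le_card_mul _ _ 9 fun l _ => Finset.card_image_le.trans ?_).trans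
        (Nat.mul_le_mul_right 9 hF)
      cases l with
      | nil => simp
      | cons b t => simpa using card_near_le b
    · intro l hl hc
      match l, hl, hc with
      | a :: b :: t, hl, hc =>
        rw [List.isChain_cons_cons] at hc
        refine Finset.mem_biUnion.mpr ⟨b :: t, hmem _ (by simpa using hl) hc.2, ?_⟩
        refine Finset.mem_image.mpr ⟨a, ?_, rfl⟩
        obtain ⟨⟨h1, h2, h3, h4⟩, -⟩ := hc
        have hN : Near b a := ⟨h2, h1, h4, h3⟩
        simpa using hN

/-! ### Connected regions in a side are segments -/

/-- The projection of the region to the row direction is an interval. It contains the midpoint of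
every intermediate square, and among the squares of the row only that one projects onto the
midpoint. -/
lemma isRowSegment_of_isConnectedRegion {M : ℕ} {c : ℝ × ℝ} {A : Finset (Site M)} {y : ℕ}
    (hA : ∀ κ ∈ A, (κ.2 : ℕ) = y) (h : IsConnectedRegion c A) : IsRowSegment A := by
  refine ⟨y, hA, fun κ hκ κ' hκ' κ'' h2 hle hle' => ?_⟩
  have hord := (h.image Prod.fst continuous_fst.continuousOn).isPreconnected.ordConnected
  have hmem : ∀ κ ∈ A, c.1 + (κ.1 : ℕ) - 1 / 2 ∈ Prod.fst '' ⋃ κ ∈ A, unitSquare c κ := by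
    intro κ hκ
    refine ⟨(c.1 + (κ.1 : ℕ) - 1 / 2, c.2 + (κ.2 : ℕ)), Set.mem_biUnion hκ ?_, rfl⟩
    refine ⟨⟨?_, ?_⟩, ⟨?_, ?_⟩⟩ <;> simp only <;> linarith
  have hle₁ : ((κ.1 : ℕ) : ℝ) ≤ (κ''.1 : ℕ) := by exact_mod_cast hle
  have hle₂ : ((κ''.1 : ℕ) : ℝ) ≤ (κ'.1 : ℕ) := by exact_mod_cast hle'
  obtain ⟨x, hx, hxe⟩ := hord.out (hmem κ hκ) (hmem κ' hκ')
    (⟨by linarith, by linarith⟩ : c.1 + (κ''.1 : ℕ) - 1 / 2 ∈ Set.Icc _ _)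
  obtain ⟨a, ha, hxa⟩ := Set.mem_iUnion₂.mp hx
  have hxa₁ := hxa.1
  rw [Set.mem_Icc, hxe] at hxa₁
  have e1 : ((a.1 : ℕ) : ℝ) < (κ''.1 : ℕ) + 1 := by linarith [hxa₁.1]
  have e2 : ((κ''.1 : ℕ) : ℝ) < (a.1 : ℕ) + 1 := by linarith [hxa₁.2]
  have e3 : (a.1 : ℕ) < (κ''.1 : ℕ) + 1 := by exact_mod_cast e1
  have e4 : (κ''.1 : ℕ) < (a.1 : ℕ) + 1 := by exact_mod_cast e2
  have : a = κ'' := pos_injective (Prod.ext (by simp only [pos]; omega) ((hA a ha).trans h2.symm))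
  exact this ▸ ha

lemma isColSegment_of_isConnectedRegion {M : ℕ} {c : ℝ × ℝ} {A : Finset (Site M)} {x : ℕ}
    (hA : ∀ κ ∈ A, (κ.1 : ℕ) = x) (h : IsConnectedRegion c A) : IsColSegment A := by
  refine ⟨x, hA, fun κ hκ κ' hκ' κ'' h1 hle hle' => ?_⟩
  have hord := (h.image Prod.snd continuous_snd.continuousOn).isPreconnected.ordConnected
  have hmem : ∀ κ ∈ A, c.2 + (κ.2 : ℕ) - 1 / 2 ∈ Prod.snd '' ⋃ κ ∈ A, unitSquare c κ := by
    intro κ hκ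
    refine ⟨(c.1 + (κ.1 : ℕ), c.2 + (κ.2 : ℕ) - 1 / 2), Set.mem_biUnion hκ ?_, rfl⟩
    refine ⟨⟨?_, ?_⟩, ⟨?_, ?_⟩⟩ <;> simp only <;> linarith
  have hle₁ : ((κ.2 : ℕ) : ℝ) ≤ (κ''.2 : ℕ) := by exact_mod_cast hle
  have hle₂ : ((κ''.2 : ℕ) : ℝ) ≤ (κ'.2 : ℕ) := by exact_mod_cast hle'
  obtain ⟨z, hz, hze⟩ := hord.out (hmem κ hκ) (hmem κ' hκ')
    (⟨by linarith, by linarith⟩ : c.2 + (κ''.2 : ℕ) - 1 / 2 ∈ Set.Icc _ _)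
  obtain ⟨a, ha, hza⟩ := Set.mem_iUnion₂.mp hz
  have hza₂ := hza.2
  rw [Set.mem_Icc, hze] at hza₂
  have e1 : ((a.2 : ℕ) : ℝ) < (κ''.2 : ℕ) + 1 := by linarith [hza₂.1]
  have e2 : ((κ''.2 : ℕ) : ℝ) < (a.2 : ℕ) + 1 := by linarith [hza₂.2]
  have e3 : (a.2 : ℕ) < (κ''.2 : ℕ) + 1 := by exact_mod_cast e1
  have e4 : (κ''.2 : ℕ) < (a.2 : ℕ) + 1 := by exact_mod_cast e2
  have : a = κ'' := pos_injective (Prod.ext ((hA a ha).trans h1.symm) (by simp only [pos]; omega))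
  exact this ▸ ha

lemma isSegment_of_subset_side {M : ℕ} {c : ℝ × ℝ} {A : Finset (Site M)} {k : Fin 4}
    (hA : (A : Set (Site M)) ⊆ side M k) (h : IsConnectedRegion c A) :
    IsRowSegment A ∨ IsColSegment A := by
  match k with
  | 0 => exact Or.inl (isRowSegment_of_isConnectedRegion (fun κ hκ => hA hκ) h)
  | 1 => exact Or.inr (isColSegment_of_isConnectedRegion (fun κ hκ => hA hκ) h)
  | 2 => exact Or.inl (isRowSegment_of_isConnectedRegion (fun κ hκ => hA hκ) h)
  | 3 => exact Or.inr (isColSegment_of_isConnectedRegion (fun κ hκ => hA hκ) h)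

/-! ### The probability that given sites are closed -/

lemma centralSquare_eq_prod {M : ℕ} (s : ℝ) (c : ℝ × ℝ) (κ : Site M) :
    centralSquare s c κ =
      Set.Icc (c.1 + (κ.1 : ℕ) - 1 / 2 - √s / 2) (c.1 + (κ.1 : ℕ) - 1 / 2 + √s / 2) ×ˢ
        Set.Icc (c.2 + (κ.2 : ℕ) - 1 / 2 - √s / 2) (c.2 + (κ.2 : ℕ) - 1 / 2 + √s / 2) := by
  ext x
  simp only [centralSquare, Set.mem_ofPred_eq, Set.mem_prod, Set.mem_Icc, abs_le]
  constructor <;> rintro ⟨⟨h1, h2⟩, h3, h4⟩ <;>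
    exact ⟨⟨by linarith, by linarith⟩, by linarith, by linarith⟩

lemma measurableSet_centralSquare {M : ℕ} (s : ℝ) (c : ℝ × ℝ) (κ : Site M) :
    MeasurableSet (centralSquare s c κ) := by
  rw [centralSquare_eq_prod]
  exact measurableSet_Icc.prod measurableSet_Icc

lemma volume_centralSquare {M : ℕ} {s : ℝ} (hs : 0 ≤ s) (c : ℝ × ℝ) (κ : Site M) :
    volume (centralSquare s c κ) = ENNReal.ofReal s := by
  rw [centralSquare_eq_prod, Measure.volume_eq_prod, Measure.prod_prod, Real.volume_Icc,
    Real.volume_Icc, ← ENNReal.ofReal_mul (by ring_nf; positivity)]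
  congr 1
  ring_nf
  exact Real.sq_sqrt hs

lemma disjoint_centralSquare {M : ℕ} {s : ℝ} (hs : s < 1) (c : ℝ × ℝ) {κ κ' : Site M}
    (hne : κ ≠ κ') : Disjoint (centralSquare s c κ) (centralSquare s c κ') := by
  have hs' : √s < 1 := by rw [Real.sqrt_lt' one_pos]; simpa using hs
  rw [Set.disjoint_left]
  rintro x ⟨h1, h2⟩ ⟨h3, h4⟩
  rw [abs_le] at h1 h2 h3 h4
  apply hne
  have a1 : ((κ.1 : ℕ) : ℝ) < (κ'.1 : ℕ) + 1 := by linarith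
  have a2 : ((κ'.1 : ℕ) : ℝ) < (κ.1 : ℕ) + 1 := by linarith
  have a3 : ((κ.2 : ℕ) : ℝ) < (κ'.2 : ℕ) + 1 := by linarith
  have a4 : ((κ'.2 : ℕ) : ℝ) < (κ.2 : ℕ) + 1 := by linarith
  norm_cast at a1 a2 a3 a4
  exact pos_injective (Prod.ext (by simp only [pos]; omega) (by simp only [pos]; omega))

lemma centralSquare_subset {M L : ℕ} {s : ℝ} (hs : s < 1) {c : ℝ × ℝ}
    (h1 : 0 ≤ c.1) (h1' : c.1 + M ≤ L) (h2 : 0 ≤ c.2) (h2' : c.2 + M ≤ L) (κ : Site M) :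
    centralSquare s c κ ⊆ Set.Icc (0 : ℝ) L ×ˢ Set.Icc (0 : ℝ) L := by
  have hs' : √s < 1 := by rw [Real.sqrt_lt' one_pos]; simpa using hs
  rintro x ⟨hx, hy⟩
  rw [abs_le] at hx hy
  have b1 : (1 : ℝ) ≤ (κ.1 : ℕ) := by exact_mod_cast κ.1.2.1
  have b2 : ((κ.1 : ℕ) : ℝ) ≤ M := by exact_mod_cast κ.1.2.2
  have b3 : (1 : ℝ) ≤ (κ.2 : ℕ) := by exact_mod_cast κ.2.2.1
  have b4 : ((κ.2 : ℕ) : ℝ) ≤ M := by exact_mod_cast κ.2.2.2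
  exact ⟨⟨by linarith, by linarith⟩, by linarith, by linarith⟩

lemma isProbabilityMeasure_uniform {L : ℕ} (hL : 0 < L) : IsProbabilityMeasure
    (ProbabilityTheory.cond (volume : Measure (ℝ × ℝ))
      (Set.Icc (0 : ℝ) L ×ˢ Set.Icc (0 : ℝ) L)) := by
  have hL' : (0 : ℝ) < L := by exact_mod_cast hL
  apply cond_isProbabilityMeasure_of_finite
  · rw [Measure.volume_eq_prod, Measure.prod_prod]
    simp [hL.ne']
  · rw [Measure.volume_eq_prod, Measure.prod_prod]
    simp [ENNReal.mul_eq_top]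

/-- The probability that one uniform point avoids the central squares of given sites. -/
lemma uniform_compl_biUnion {M L : ℕ} {s : ℝ} (hL : 0 < L) (hs0 : 0 ≤ s) (hs1 : s < 1)
    {c : ℝ × ℝ} (h1 : 0 ≤ c.1) (h1' : c.1 + M ≤ L) (h2 : 0 ≤ c.2) (h2' : c.2 + M ≤ L)
    (T : Finset (Site M)) :
    (ProbabilityTheory.cond (volume : Measure (ℝ × ℝ))
      (Set.Icc (0 : ℝ) L ×ˢ Set.Icc (0 : ℝ) L)).real (⋃ κ ∈ T, centralSquare s c κ)ᶜ =
        1 - T.card * s / (L : ℝ) ^ 2 := by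
  have := isProbabilityMeasure_uniform hL
  have hmeas : MeasurableSet (⋃ κ ∈ T, centralSquare s c κ) :=
    T.measurableSet_biUnion fun κ _ => measurableSet_centralSquare s c κ
  rw [probReal_compl_eq_one_sub hmeas]
  congr 1
  rw [measureReal_def, cond_apply (measurableSet_Icc.prod measurableSet_Icc),
    Set.inter_eq_right.mpr (Set.iUnion₂_subset fun κ _ => centralSquare_subset hs1 h1 h1' h2 h2' κ),
    measure_biUnion_finset (fun κ _ κ' _ hne => disjoint_centralSquare hs1 c hne)
      (fun κ _ => measurableSet_centralSquare s c κ)]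
  simp_rw [volume_centralSquare hs0]
  rw [Measure.volume_eq_prod, Measure.prod_prod]
  simp [hs0, Real.volume_Icc]
  field_simp

/-- The probability that given sites are all closed. -/
lemma grainLaw_closed_le {M L : ℕ} {s ν : ℝ} (hL : 0 < L) (hs0 : 0 ≤ s) (hs1 : s < 1)
    {c : ℝ × ℝ} (h1 : 0 ≤ c.1) (h1' : c.1 + M ≤ L) (h2 : 0 ≤ c.2) (h2' : c.2 + M ≤ L)
    (T : Finset (Site M)) :
    (grainLaw ν L).real {ω | ∀ κ ∈ T, siteConfig M s c ω κ ≠ 1} ≤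
      Real.exp (-(T.card * s * (ν - 1))) := by
  have hprob := isProbabilityMeasure_uniform hL
  have hL' : (1 : ℝ) ≤ L := by exact_mod_cast hL
  -- The sites of `T` are all closed exactly when every centre avoids the union of their central
  -- squares. This is a product event, so independence of the sites is not needed.
  have hset : {ω : Fin (numGrains ν L) → ℝ × ℝ | ∀ κ ∈ T, siteConfig M s c ω κ ≠ 1} =
      Set.univ.pi fun _ => (⋃ κ ∈ T, centralSquare s c κ)ᶜ := by
    ext ω
    simp only [siteConfig, Set.mem_ofPred_eq, Set.mem_pi, Set.mem_univ, true_imp_iff,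
      Set.mem_compl_iff, Set.mem_iUnion, not_exists]
    constructor
    · intro h j κ hκ hj
      exact h κ hκ (if_pos ⟨j, hj⟩)
    · intro h κ hκ
      rw [if_neg (by rintro ⟨j, hj⟩; exact h j κ hκ hj)]
      decide
  have hu := uniform_compl_biUnion hL hs0 hs1 h1 h1' h2 h2' T
  have hN : ν * (L : ℝ) ^ 2 - 1 < numGrains ν L := Nat.sub_one_lt_floor _
  -- The loss of one centre to the floor is absorbed by `L² ≥ 1`; this is the origin of `ν - 1`.
  have hN' : (ν - 1) * (L : ℝ) ^ 2 ≤ numGrains ν L := by nlinarith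
  rw [hset, grainLaw, measureReal_def, Measure.pi_pi, Finset.prod_const, ENNReal.toReal_pow,
    ← measureReal_def, hu, Finset.card_univ, Fintype.card_fin]
  calc (1 - T.card * s / (L : ℝ) ^ 2) ^ numGrains ν L
      ≤ Real.exp (-(T.card * s / (L : ℝ) ^ 2)) ^ numGrains ν L :=
        pow_le_pow_left₀ (hu ▸ measureReal_nonneg) (Real.one_sub_le_exp_neg _) _
    _ = Real.exp (-(T.card * s / (L : ℝ) ^ 2 * numGrains ν L)) := by
        rw [← Real.exp_nat_mul]; congr 1; ring
    _ ≤ Real.exp (-(T.card * s * (ν - 1))) := by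
        apply Real.exp_le_exp.mpr
        rw [neg_le_neg_iff]
        calc T.card * s * (ν - 1)
            = T.card * s / (L : ℝ) ^ 2 * ((ν - 1) * (L : ℝ) ^ 2) := by field_simp
          _ ≤ _ := by gcongr

/-! ### Union bound over closed paths -/

open Classical in
/-- The probability of a closed path of given length. -/
lemma grainLaw_exists_isClosedPath_le {M L n : ℕ} {s ν : ℝ} (hL : 0 < L) (hs0 : 0 ≤ s)
    (hs1 : s < 1) {c : ℝ × ℝ} (h1 : 0 ≤ c.1) (h1' : c.1 + M ≤ L) (h2 : 0 ≤ c.2)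
    (h2' : c.2 + M ≤ L) (hn : 1 ≤ n) :
    (grainLaw ν L).real {ω | ∃ l, IsClosedPath (siteConfig M s c ω) l ∧ l.length = n} ≤
      M ^ 2 * 9 ^ (n - 1) * Real.exp (-(n * s * (ν - 1))) := by
  have hprob := isProbabilityMeasure_uniform hL
  have : IsProbabilityMeasure (grainLaw ν L) := by unfold grainLaw; infer_instance
  obtain ⟨F, hF, hmem⟩ := exists_finset_chains M (n - 1)
  -- Without repetitions, `l.toFinset` has exactly `n` sites, which gives the full exponent.
  set G := F.filter fun l => l.Nodup ∧ l.length = n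
  have hsub : {ω | ∃ l, IsClosedPath (siteConfig M s c ω) l ∧ l.length = n} ⊆
      ⋃ l ∈ G, {ω : Fin (numGrains ν L) → ℝ × ℝ |
        ∀ κ ∈ l.toFinset, siteConfig M s c ω κ ≠ 1} := by
    rintro ω ⟨l, ⟨hnd, hch, hcl⟩, hlen⟩
    refine Set.mem_biUnion (Finset.mem_filter.mpr ⟨hmem l (by omega) hch, hnd, hlen⟩) ?_
    intro κ hκ
    exact hcl κ (List.mem_toFinset.mp hκ)
  calc _ ≤ (grainLaw ν L).real (⋃ l ∈ G, {ω : Fin (numGrains ν L) → ℝ × ℝ |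
        ∀ κ ∈ l.toFinset, siteConfig M s c ω κ ≠ 1}) := measureReal_mono hsub (measure_ne_top _ _)
    _ ≤ ∑ l ∈ G, (grainLaw ν L).real {ω : Fin (numGrains ν L) → ℝ × ℝ |
        ∀ κ ∈ l.toFinset, siteConfig M s c ω κ ≠ 1} := measureReal_biUnion_finset_le _ _
    _ ≤ ∑ l ∈ G, Real.exp (-(n * s * (ν - 1))) := by
        refine Finset.sum_le_sum fun l hl => ?_
        obtain ⟨-, hnd, hlen⟩ := Finset.mem_filter.mp hl
        have := grainLaw_closed_le (ν := ν) hL hs0 hs1 h1 h1' h2 h2' l.toFinset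
        rwa [List.toFinset_card_of_nodup hnd, hlen] at this
    _ = G.card * Real.exp (-(n * s * (ν - 1))) := by rw [Finset.sum_const, nsmul_eq_mul]
    _ ≤ _ := by
        gcongr
        exact_mod_cast (Finset.card_filter_le _ _).trans hF

/-- The entropy of closed paths is beaten by their probability at high density. -/
lemma path_bound_le_exp {M n : ℕ} {s ν : ℝ} (hs : 0 < s) (hν : 1 + 17 / s ≤ ν)
    (hMn : (M : ℝ) ≤ 4 * n) :
    (M : ℝ) ^ 2 * 9 ^ (n - 1) * Real.exp (-(n * s * (ν - 1))) ≤ Real.exp (-(M / 4)) := by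
  have e1 : (M : ℝ) ^ 2 ≤ Real.exp (8 * n) := by
    calc (M : ℝ) ^ 2 ≤ Real.exp (4 * n) ^ 2 := by
          gcongr; linarith [Real.add_one_le_exp (4 * n : ℝ)]
      _ = Real.exp (8 * n) := by rw [← Real.exp_nat_mul]; congr 1; push_cast; ring
  have e2 : (9 : ℝ) ^ (n - 1) ≤ Real.exp (8 * n) := by
    calc (9 : ℝ) ^ (n - 1) ≤ 9 ^ n := pow_le_pow_right₀ (by norm_num) (by omega)
      _ ≤ Real.exp 8 ^ n := by gcongr; linarith [Real.add_one_le_exp (8 : ℝ)]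
      _ = Real.exp (8 * n) := by rw [← Real.exp_nat_mul]; congr 1; ring
  -- 17 = 8 + 8 + 1: the two entropy factors cost `exp (8 n)` each, and `exp (-n) ≤ exp (-M / 4)` is
  -- left.
  have e3 : 17 ≤ s * (ν - 1) := by
    have : 17 / s ≤ ν - 1 := by linarith
    rw [div_le_iff₀ hs] at this
    linarith
  have e4 : (n : ℝ) * 17 ≤ n * (s * (ν - 1)) := by gcongr
  calc _ ≤ Real.exp (8 * n) * Real.exp (8 * n) * Real.exp (-(n * s * (ν - 1))) := by gcongr
    _ = Real.exp (8 * n + 8 * n - n * s * (ν - 1)) := by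
        rw [← Real.exp_add, ← Real.exp_add]; congr 1
    _ ≤ _ := Real.exp_le_exp.mpr (by linarith)

end GrainPercolation

end

/-! ### Assembly of the main estimate -/

theorem mainTheorem4 (s : ℝ) (hs0 : 0 < s) (hs1 : s < 1) :
    ∃ ν₀ : ℝ, 0 < ν₀ ∧ ∃ K : ℝ, 0 < K ∧
      ∀ (a V ε₀ : ℝ) (ε : ℕ → ℝ),
        0 < a → 0 < V → V < 1 → 0 < ε₀ → ε₀ < min V (1 - V) →
        (∀ L, 0 < ε L) → Tendsto ε atTop (𝓝 0) →
        (fun L : ℕ => a / (L : ℝ)) =o[atTop] ε →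
        ∃ L₀ : ℕ, 0 < L₀ ∧
          ∀ ν : ℝ, ν₀ ≤ ν → ∀ L : ℕ, L₀ ≤ L →
          ∀ M m n : ℕ, (M : ℝ) = ε L * L → (m : ℝ) = 1 / ε L → (n : ℝ) = 2 * ε₀ / ε L →
          ∀ p q : ℕ, p < m → q < n →
          ∀ k l : Fin 4, k ≠ l →
          ∀ A₁ A₂ : Finset (GrainPercolation.Site M),
            (A₁ : Set (GrainPercolation.Site M)) ⊆ GrainPercolation.side M k →
            (A₂ : Set (GrainPercolation.Site M)) ⊆ GrainPercolation.side M l →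
            Disjoint A₁ A₂ →
            GrainPercolation.IsConnectedRegion
              (GrainPercolation.boxCorner V ε₀ (ε L) L p q) A₁ →
            GrainPercolation.IsConnectedRegion
              (GrainPercolation.boxCorner V ε₀ (ε L) L p q) A₂ →
            (A₁.card : ℝ) ∈ Set.Ioo ((M : ℝ) / 4) ((M : ℝ) / 2) →
            (A₂.card : ℝ) ∈ Set.Ioo ((M : ℝ) / 4) ((M : ℝ) / 2) →
            1 - Real.exp (-(K * ε L * L)) ≤
              GrainPercolation.siteProb ν s L M
                (GrainPercolation.boxCorner V ε₀ (ε L) L p q)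
                (GrainPercolation.connectionEvent A₁ A₂) := by
  open GrainPercolation in
  refine ⟨1 + 17 / s, by positivity, 1 / 4, by norm_num, ?_⟩
  intro a V ε₀ ε _ _ _ _ hε₀ hε _ _
  refine ⟨1, one_pos, ?_⟩
  intro ν hν L hL M m n hM hm hn p q hp hq k l _ A₁ A₂ hA₁ hA₂ hd hc₁ hc₂ hN₁ hN₂
  have hεL := hε L
  have hL' : (1 : ℝ) ≤ L := by exact_mod_cast hL
  obtain ⟨hε₀V, hε₀V'⟩ := lt_min_iff.mp hε₀
  have hmM : (m : ℝ) * M = L := by rw [hm, hM]; field_simp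
  -- This and the previous identity say that the boxes fill the strip exactly, so each box lies in
  -- `[0, L]²`, where the law of the centres is uniform.
  have hnM : (n : ℝ) * M = 2 * ε₀ * L := by rw [hn, hM]; field_simp
  have hp' : (p : ℝ) + 1 ≤ m := by exact_mod_cast hp
  have hq' : (q : ℝ) + 1 ≤ n := by exact_mod_cast hq
  have hM0 : (0 : ℝ) ≤ M := Nat.cast_nonneg M
  have hp0 : (0 : ℝ) ≤ p * M := by positivity
  have hq0 : (0 : ℝ) ≤ q * M := by positivity
  have hpM : ((p : ℝ) + 1) * M ≤ m * M := by gcongr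
  have hqM : ((q : ℝ) + 1) * M ≤ n * M := by gcongr
  have hVL : 0 ≤ (V - ε₀) * L := by apply mul_nonneg <;> linarith
  have hVL' : (V + ε₀) * L ≤ L := by nlinarith
  have b1 : 0 ≤ (boxCorner V ε₀ (ε L) L p q).1 := by simpa only [boxCorner, ← hM] using hp0
  have b1' : (boxCorner V ε₀ (ε L) L p q).1 + M ≤ L := by
    simp only [boxCorner, ← hM]; linarith
  have b2 : 0 ≤ (boxCorner V ε₀ (ε L) L p q).2 := by simp only [boxCorner, ← hM]; linarith
  have b2' : (boxCorner V ε₀ (ε L) L p q).2 + M ≤ L := by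
    simp only [boxCorner, ← hM]; linarith
  set c := boxCorner V ε₀ (ε L) L p q
  set r := ⌈(M : ℝ) / 4⌉₊
  have hr₁ : r ≤ A₁.card := Nat.ceil_le.mpr hN₁.1.le
  have hr₂ : r ≤ A₂.card := Nat.ceil_le.mpr hN₂.1.le
  have hMpos : (0 : ℝ) < M := by linarith [hN₁.1, hN₁.2]
  have hr : 1 ≤ r := Nat.ceil_pos.mpr (by positivity)
  have hrM : r ≤ M := Nat.ceil_le.mpr (by linarith)
  have hMr : (M : ℝ) ≤ 4 * r := by linarith [Nat.le_ceil ((M : ℝ) / 4)]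
  have hprob := isProbabilityMeasure_uniform (show 0 < L from hL)
  have : IsProbabilityMeasure (grainLaw ν L) := by unfold grainLaw; infer_instance
  have hcover : Set.univ ⊆ {ω : Fin (numGrains ν L) → ℝ × ℝ |
        siteConfig M s c ω ∈ connectionEvent A₁ A₂} ∪
      {ω | ∃ l, IsClosedPath (siteConfig M s c ω) l ∧ l.length = r} := by
    intro ω _
    by_cases h : siteConfig M s c ω ∈ connectionEvent A₁ A₂
    · exact Or.inl h
    · exact Or.inr (exists_isClosedPath hr (isSegment_of_subset_side hA₁ hc₁)
        (isSegment_of_subset_side hA₂ hc₂) hd hr₁ hr₂ hrM h)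
  -- Monotonicity and subadditivity hold for arbitrary sets, so no measurability of the events is
  -- required.
  have h1 : (1 : ℝ) ≤ (grainLaw ν L).real {ω | siteConfig M s c ω ∈ connectionEvent A₁ A₂} +
      (grainLaw ν L).real {ω | ∃ l, IsClosedPath (siteConfig M s c ω) l ∧ l.length = r} := by
    rw [← probReal_univ (μ := grainLaw ν L)]
    exact (measureReal_mono hcover).trans (measureReal_union_le _ _)
  have h2 := (grainLaw_exists_isClosedPath_le (ν := ν) hL hs0.le hs1 b1 b1' b2 b2' hr).trans
    (path_bound_le_exp hs0 hν hMr)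
  have h3 : 1 / 4 * ε L * L = (M : ℝ) / 4 := by rw [hM]; ring
  rw [h3, siteProb]
  linarith
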